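/- Consider the problem $\min_{x\in C} f(x)+g(Ax)$, where $A:\mathbb{R}^n\to\mathbb{R}^m$ is linear, $C\subseteq\mathbb{R}^n$ is a nonempty convex set, $f:\mathbb{R}^n\to\mathbb{R}$ is continuously differentiable on $C$, $g:\mathbb{R}^m\to\mathbb{R}\cup\{\infty\}$ is polyhedral convex (its epigraph is a finite intersection of closed half-spaces), and some $x$ in the relative interior of $C$ satisfies $Ax\in\operatorname{dom} g$. Let $(\bar x,\bar\lambda)\in\mathbb{R}^n\times\mathbb{R}^m$ satisfy: (i) $0\in N_C(\bar x)+\nabla f(\bar x)+A^\top\bar\lambda$ and $\bar\lambda\in\partial g(A\bar x)$, where $N_C(\bar x)=\partial\delta_C(\bar x)$ is the normal cone and $\delta_C$ is the indicator function of $C$; (ii) $f$ is twice continuously differentiable in a neighborhood of $\bar x$, and $\langle v,\nabla^2 f(\bar x)v\rangle>0$ for every nonzero $v\in V_C$ with $Av\in S(A\bar x\mid\bar\lambda)$. Here $V_C$ is the linear subspace parallel to the affine hull of $C$, and $S(A\bar x\mid\bar\lambda)$ is the smallest subspace containing the cone $\{w\mid g'(A\bar x;w)=\langle\bar\lambda,w\rangle\}$,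 with $g'(y;w)=\lim_{t\downarrow0}(g(y+tw)-g(y))/t$. For $\beta>0$, the ADMM iterates from $(y^0,\lambda^0)$ are any sequences with, for all $k\ge0$, $$x^{k+1}\in\arg\min_{x\in C} f(x)+\langle\lambda^k,Ax\rangle+\tfrac{\beta}{2}\|Ax-y^k\|^2,$$ $$y^{k+1}\in\arg\min_{y}\, g(y)-\langle\lambda^k,y\rangle+\tfrac{\beta}{2}\|Ax^{k+1}-y\|^2,$$ $$\lambda^{k+1}=\lambda^k+\beta(Ax^{k+1}-y^{k+1}),$$ and the reduced augmented Lagrangian is $$\ell_\beta(x,\lambda)=\inf_{y}\; f(x)+\delta_C(x)+g(y)+\langle\lambda,Ax-y\rangle+\tfrac{\beta}{2}\|Ax-y\|^2 .$$ Then there exists $\beta_0>0$ such that for every $\beta>2\beta_0$ there are closed neighborhoods $\mathcal{X}_\beta$ of $\bar x$ and $\Lambda_\beta$ of $\bar\lambda$ with the following property. If ADMM iterates with penalty parameter $\beta$ satisfy $\lambda^0\in\Lambda_\beta\cap\partial g(y^0)$, $B(\bar\lambda,r)\subseteq\Lambda_\beta$ with $r\ge0$, $r^2=\beta^2\|y^0-A\bar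 x\|^2+\|\lambda^0-\bar\lambda\|^2$, and $x^k\in\mathcal{X}_\beta$ for all $k\ge1$, then $(x^k,y^k,\lambda^k)$ converges to $(\bar x,A\bar x,\lambda^*)$ for some $$\lambda^*\in\mathcal{M}^*:=\{\lambda\in\Lambda_\beta\mid 0\in\partial_x\ell_\beta(\bar x,\lambda),\ 0\in\partial_\lambda[-\ell_\beta](\bar x,\lambda)\}.$$ Here $\partial$ applied to $g$ and $\delta_C$ is the subdifferential of convex analysis, while $v\in\partial\varphi(\bar z)$ for $\varphi=\ell_\beta(\cdot,\lambda)$ or $\varphi=-\ell_\beta(\bar x,\cdot)$ means that $\varphi(\bar z)$ is finite and $\varphi(z)\ge\varphi(\bar z)+\langle v,z-\bar z\rangle-o(\|z-\bar z\|)$ as $z\to\bar z$. -/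

import Mathlib

open Filter Topology
open scoped RealInnerProductSpace

noncomputable section

namespace ADMM

/-- Euclidean space of dimension `n`. -/
abbrev E (n : ℕ) : Type := EuclideanSpace ℝ (Fin n)

/-- A function `g : ℝᵐ → ℝ ∪ {∞}` (never `-∞`) is polyhedral convex if its epigraph
`{(y, t) | g y ≤ t} ⊆ ℝᵐ × ℝ` is the intersection of finitely many closed half-spaces. -/
def IsPolyhedralConvex {m : ℕ} (g : E m → EReal) : Prop :=
  (∀ y, g y ≠ ⊥) ∧
  ∃ (N : ℕ) (a : Fin N → E m) (c b : Fin N → ℝ),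
    ∀ (y : E m) (t : ℝ), g y ≤ (t : EReal) ↔ ∀ i, ⟪a i, y⟫ + c i * t ≤ b i

open Classical in
/-- The indicator function `δ_C`: zero on `C` and `+∞` outside of `C`. -/
def indicatorFn {n : ℕ} (C : Set (E n)) (x : E n) : EReal :=
  if x ∈ C then 0 else ⊤

/-- The subdifferential `∂φ(x)` of convex analysis. -/
def subdifferential {n : ℕ} (φ : E n → EReal) (x : E n) : Set (E n) :=
  {v | φ x ≠ ⊤ ∧ ∀ z, φ x + ((⟪v, z - x⟫ : ℝ) : EReal) ≤ φ z}

/-- The (regular) subdifferential of a not necessarily convex extended-real function: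
`φ(x)` is finite and `φ(z) ≥ φ(x) + ⟨v, z - x⟩ - o(‖z - x‖)` as `z → x`.
For the sum of a differentiable function and a convex function it is the gradient of the
former plus the convex subdifferential of the latter. -/
def regularSubdifferential {n : ℕ} (φ : E n → EReal) (x : E n) : Set (E n) :=
  {v | φ x ≠ ⊤ ∧ φ x ≠ ⊥ ∧ ∀ ε : ℝ, 0 < ε →
    ∀ᶠ z in 𝓝 x, φ x + ((⟪v, z - x⟫ - ε * ‖z - x‖ : ℝ) : EReal) ≤ φ z}

/-- `T_g(y | l) = {w | g'(y; w) = ⟨l, w⟩}`, where `g'(y; w)` is the one-sided directional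
derivative `lim_{t ↓ 0} (g (y + t w) - g y) / t`. -/
def dirTangent {m : ℕ} (g : E m → EReal) (y l : E m) : Set (E m) :=
  {w | Tendsto (fun t : ℝ => (g (y + t • w) - g y) / (t : EReal)) (𝓝[>] 0)
    (𝓝 ((⟪l, w⟫ : ℝ) : EReal))}

/-- `S(y | l)`, the smallest subspace containing the cone `T_g(y | l)`. -/
def tangentSpan {m : ℕ} (g : E m → EReal) (y l : E m) : Submodule ℝ (E m) :=
  Submodule.span ℝ (dirTangent g y l)

/-- Standing assumptions on the problem `min_{x ∈ C} f(x) + g(Ax)`. -/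
structure IsCompositeProblem {n m : ℕ} (f : E n → ℝ) (g : E m → EReal) (A : E n →L[ℝ] E m)
    (C : Set (E n)) : Prop where
  nonempty_C : C.Nonempty
  convex_C : Convex ℝ C
  smooth_f : ContDiffOn ℝ 1 f C
  polyhedral_g : IsPolyhedralConvex g
  /-- There is a point of the relative interior of `C` that `A` maps into `dom g`. -/
  qualification : ∃ x ∈ intrinsicInterior ℝ C, g (A x) ≠ ⊤

/-- First-order optimality:
`0 ∈ ∂δ_C(x̄) + ∇f(x̄) + Aᵀ l` and `l ∈ ∂g(A x̄)`. -/
def FirstOrderOptimal {n m : ℕ} (f : E n → ℝ) (g : E m → EReal) (A : E n →L[ℝ] E m)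
    (C : Set (E n)) (xbar : E n) (lbar : E m) : Prop :=
  -(gradient f xbar + ContinuousLinearMap.adjoint A lbar)
      ∈ subdifferential (indicatorFn C) xbar ∧
    lbar ∈ subdifferential g (A xbar)

/-- First-order optimality together with the second-order condition: `f` is twice continuously
differentiable around `x̄` and `∇²f(x̄)` is positive definite on `V_C ∩ A⁻¹ S(A x̄ | l)`, where
`V_C` is the direction of the affine hull of `C`. -/
structure SecondOrderAssumption {n m : ℕ} (f : E n → ℝ) (g : E m → EReal) (A : E n →L[ℝ] E m)
    (C : Set (E n)) (xbar : E n) (lbar : E m) : Prop where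
  first_order : FirstOrderOptimal f g A C xbar lbar
  smooth_near : ∃ U : Set (E n), IsOpen U ∧ xbar ∈ U ∧ ContDiffOn ℝ 2 f U
  hessian_pos : ∀ v : E n, v ∈ (affineSpan ℝ C).direction →
    A v ∈ tangentSpan g (A xbar) lbar → v ≠ 0 → 0 < fderiv ℝ (fderiv ℝ f) xbar v v

/-- The augmented Lagrangian
`f(x) + δ_C(x) + g(y) + ⟨l, Ax - y⟩ + (β/2) ‖Ax - y‖²`. -/
def augLagrangian {n m : ℕ} (f : E n → ℝ) (g : E m → EReal) (A : E n →L[ℝ] E m)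
    (C : Set (E n)) (β : ℝ) (x : E n) (y l : E m) : EReal :=
  (f x : EReal) + indicatorFn C x + g y +
    ((⟪l, A x - y⟫ + β / 2 * ‖A x - y‖ ^ 2 : ℝ) : EReal)

/-- The reduced augmented Lagrangian, the minimum of the augmented Lagrangian over `y`. -/
def reducedLagrangian {n m : ℕ} (f : E n → ℝ) (g : E m → EReal) (A : E n →L[ℝ] E m)
    (C : Set (E n)) (β : ℝ) (x : E n) (l : E m) : EReal :=
  ⨅ y : E m, augLagrangian f g A C β x y l

/-- The set `M*` of the `l ∈ Λ` for which `(x̄, l)` is stationary for the reduced augmented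
Lagrangian `ℓ_β`: `0 ∈ ∂ₓ ℓ_β(x̄, l)` and `0 ∈ ∂ₗ [-ℓ_β](x̄, l)`. -/
def multiplierSet {n m : ℕ} (f : E n → ℝ) (g : E m → EReal) (A : E n →L[ℝ] E m)
    (C : Set (E n)) (β : ℝ) (xbar : E n) (Λ : Set (E m)) : Set (E m) :=
  {l | l ∈ Λ ∧
    (0 : E n) ∈ regularSubdifferential (fun x => reducedLagrangian f g A C β x l) xbar ∧
    (0 : E m) ∈ regularSubdifferential (fun l' => -reducedLagrangian f g A C β xbar l') l}

/-- `(x, y, l)` is generated by ADMM with penalty `β` from `(y 0, l 0)`; the minimizers are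
global, and any of them may be taken when they are not unique. The value `x 0` plays no role. -/
structure IsADMMSequence {n m : ℕ} (f : E n → ℝ) (g : E m → EReal) (A : E n →L[ℝ] E m)
    (C : Set (E n)) (β : ℝ) (x : ℕ → E n) (y l : ℕ → E m) : Prop where
  x_mem : ∀ k, x (k + 1) ∈ C
  x_min : ∀ k, IsMinOn (fun z => f z + ⟪l k, A z⟫ + β / 2 * ‖A z - y k‖ ^ 2) C (x (k + 1))
  y_min : ∀ k, IsMinOn
    (fun z => g z + ((⟪l k, -z⟫ + β / 2 * ‖A (x (k + 1)) - z‖ ^ 2 : ℝ) : EReal))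
    Set.univ (y (k + 1))
  l_step : ∀ k, l (k + 1) = l k + β • (A (x (k + 1)) - y (k + 1))

end ADMM

end

namespace ADMM

variable {n m : ℕ}

/-! ### Convex subdifferentials of extended-real functions -/

/-! The proof is the Lyapunov argument of convex ADMM, with convexity recovered locally. By
Finsler's lemma (`exists_pos_penalty`) the Hessian is positive definite on `V_C` once a multiple `b`
of the squared component of `A v` orthogonal to `S` is added. Hence `∇f` is strongly monotone at
`x̄` up to a deficit `b‖A(x - x̄) - s‖²`, for every `s ∈ S` (`exists_monotone`).

Polyhedrality supplies the right `s`: a multiplier near `l̄` that is a subgradient at `y` forces `l̄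
∈ ∂g(y)`, so `g` is affine on the segment from `A x̄` to `y` and `y - A x̄ ∈ S`. With this `s` the
deficit is `b‖Ax - y‖²`, which the ADMM estimate absorbs when `β > 2b` (`lyapunov_descent`).

Thus `β²‖y - A x̄‖² + ‖l - l*‖²` decreases for every optimal multiplier `l*`. The case `l* = l̄`
keeps the multipliers in `Λ`; a cluster point taken as `l*` gives convergence of the whole sequence
(`converges`). -/

lemma exists_real_of_mem_subdifferential {g : E m → EReal} (hbot : ∀ y, g y ≠ ⊥) {y v : E m}
    (h : v ∈ subdifferential g y) : ∃ r : ℝ, g y = r :=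
  ⟨(g y).toReal, (EReal.coe_toReal h.1 (hbot y)).symm⟩

lemma mem_subdifferential_iff {g : E m → EReal} {y v : E m} {r : ℝ} (hr : g y = r) :
    v ∈ subdifferential g y ↔ ∀ (z : E m) (t : ℝ), g z ≤ t → r + ⟪v, z - y⟫ ≤ t := by
  constructor
  · rintro ⟨-, h⟩ z t hz
    have := (h z).trans hz
    rw [hr] at this
    exact_mod_cast this
  · intro h
    refine ⟨by simp [hr], fun z => ?_⟩
    rw [hr]
    refine EReal.le_of_forall_lt_iff_le.1 fun t ht => ?_
    exact_mod_cast h z t ht.le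

lemma subdifferential_monotone {g : E m → EReal} (hbot : ∀ y, g y ≠ ⊥) {y z u v : E m}
    (hu : u ∈ subdifferential g y) (hv : v ∈ subdifferential g z) :
    0 ≤ ⟪u - v, y - z⟫ := by
  obtain ⟨r, hr⟩ := exists_real_of_mem_subdifferential hbot hu
  obtain ⟨s, hs⟩ := exists_real_of_mem_subdifferential hbot hv
  have h1 := (mem_subdifferential_iff hr).1 hu z s hs.le
  have h2 := (mem_subdifferential_iff hs).1 hv y r hr.le
  rw [← neg_sub y z, inner_neg_right] at h1
  rw [inner_sub_left]
  linarith

/-! ### Polyhedral functions -/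

lemma IsPolyhedralConvex.le_segment {g : E m → EReal} (hg : IsPolyhedralConvex g) {y z : E m}
    {r s t : ℝ} (hy : g y ≤ r) (hz : g z ≤ s) (h0 : 0 ≤ t) (h1 : t ≤ 1) :
    g (y + t • (z - y)) ≤ ((r + t * (s - r) : ℝ) : EReal) := by
  obtain ⟨-, N, a, c, b, h⟩ := hg
  rw [h] at hy hz ⊢
  intro i
  have e : ⟪a i, y + t • (z - y)⟫ + c i * (r + t * (s - r))
      = (1 - t) * (⟪a i, y⟫ + c i * r) + t * (⟪a i, z⟫ + c i * s) := by
    rw [inner_add_right, inner_smul_right, inner_sub_right]; ring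
  rw [e]
  have := mul_le_mul_of_nonneg_left (hy i) (sub_nonneg.2 h1)
  have := mul_le_mul_of_nonneg_left (hz i) h0
  linarith

/-- The subgradients at a point of a polyhedral function, expressed through the set `I` of the
constraints of the epigraph that are active there. -/
def activeSubgradients {N : ℕ} (a : Fin N → E m) (c : Fin N → ℝ) (I : Set (Fin N)) :
    Set (E m) :=
  {v | ∀ (w : E m) (s : ℝ), (∀ i ∈ I, ⟪a i, w⟫ + c i * s ≤ 0) → ⟪v, w⟫ ≤ s}

lemma isClosed_activeSubgradients {N : ℕ} (a : Fin N → E m) (c : Fin N → ℝ)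
    (I : Set (Fin N)) : IsClosed (activeSubgradients a c I) := by
  simp only [activeSubgradients, Set.ofPred_forall]
  refine isClosed_iInter fun w => isClosed_iInter fun s => isClosed_iInter fun _ => ?_
  exact isClosed_le (by fun_prop) continuous_const

/-- Inactive constraints survive a small step, so the active ones alone determine the feasible
directions of the epigraph at `(y, r)`. Consequently `g` has only finitely many distinct nonempty
subdifferentials. -/
lemma subdifferential_eq_activeSubgradients {g : E m → EReal} {N : ℕ} {a : Fin N → E m}
    {c b : Fin N → ℝ} (h : ∀ (y : E m) (t : ℝ), g y ≤ (t : EReal) ↔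
      ∀ i, ⟪a i, y⟫ + c i * t ≤ b i) {y : E m} {r : ℝ} (hr : g y = r) :
    subdifferential g y = activeSubgradients a c {i | ⟪a i, y⟫ + c i * r = b i} := by
  have hy := (h y r).1 hr.le
  ext v
  rw [mem_subdifferential_iff hr]
  constructor
  · intro hv w s hws
    have key : ∀ᶠ t : ℝ in 𝓝[>] 0, ∀ i, ⟪a i, y + t • w⟫ + c i * (r + t * s) ≤ b i := by
      refine eventually_all.2 fun i => ?_
      by_cases hi : ⟪a i, y⟫ + c i * r = b i
      · filter_upwards [self_mem_nhdsWithin] with t (ht : 0 < t)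
        have := mul_nonpos_of_nonneg_of_nonpos ht.le (hws i hi)
        rw [inner_add_right, inner_smul_right]
        linarith
      · have hlt := lt_of_le_of_ne (hy i) hi
        have hc : Continuous fun t : ℝ => ⟪a i, y + t • w⟫ + c i * (r + t * s) := by fun_prop
        have := hc.continuousAt.eventually_lt (x₀ := (0 : ℝ)) continuousAt_const
          (show _ < b i by simpa using hlt)
        filter_upwards [nhdsWithin_le_nhds this] with t ht using ht.le
    obtain ⟨t, ht, ht0⟩ := (key.and self_mem_nhdsWithin).exists
    have := hv _ _ ((h _ _).2 ht)
    rw [add_sub_cancel_left, inner_smul_right] at this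
    exact le_of_mul_le_mul_left (by linarith) (show 0 < t from ht0)
  · intro hv z t hz
    have hz := (h z t).1 hz
    have := hv (z - y) (t - r) fun i hi => by
      have hi : ⟪a i, y⟫ + c i * r = b i := hi
      have := hz i
      rw [inner_sub_right]
      linarith
    linarith

/-- Near a given subgradient, a polyhedral function has no other points of contact. -/
lemma IsPolyhedralConvex.eventually_mem_subdifferential {g : E m → EReal}
    (hg : IsPolyhedralConvex g) (lbar : E m) :
    ∀ᶠ l in 𝓝 lbar, ∀ y, l ∈ subdifferential g y → lbar ∈ subdifferential g y := by
  obtain ⟨hbot, N, a, c, b, h⟩ := hg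
  -- Each candidate subdifferential is closed, so its complement is a neighbourhood of `lbar`
  -- whenever it misses `lbar`; there are finitely many index sets `I` to intersect over.
  have key : ∀ᶠ l in 𝓝 lbar, ∀ I : Set (Fin N),
      l ∈ activeSubgradients a c I → lbar ∈ activeSubgradients a c I := by
    refine eventually_all.2 fun I => ?_
    by_cases hI : lbar ∈ activeSubgradients a c I
    · exact Eventually.of_forall fun _ _ => hI
    · filter_upwards [(isClosed_activeSubgradients a c I).isOpen_compl.mem_nhds hI] with l hl hl'
      exact absurd hl' hl
  filter_upwards [key] with l hl y hy
  obtain ⟨r, hr⟩ := exists_real_of_mem_subdifferential hbot hy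
  rw [subdifferential_eq_activeSubgradients h hr] at hy ⊢
  exact hl _ hy

/-- On the segment, `g` is squeezed between its chord and the affine minorant of slope `l`, which
agree at both ends; the difference quotient is therefore constant for `t ≤ 1`. -/
lemma IsPolyhedralConvex.sub_mem_dirTangent {g : E m → EReal} (hg : IsPolyhedralConvex g)
    {ybar y l : E m} (hbar : l ∈ subdifferential g ybar) (hy : l ∈ subdifferential g y) :
    y - ybar ∈ dirTangent g ybar l := by
  obtain ⟨r, hr⟩ := exists_real_of_mem_subdifferential hg.1 hbar
  obtain ⟨s, hs⟩ := exists_real_of_mem_subdifferential hg.1 hy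
  have hle := (mem_subdifferential_iff hs).1 hy ybar r hr.le
  rw [← neg_sub y ybar, inner_neg_right] at hle
  refine tendsto_const_nhds.congr' ?_
  filter_upwards [Ioc_mem_nhdsGT (zero_lt_one' ℝ)] with t ht
  have hval : g (ybar + t • (y - ybar)) = ((r + t * ⟪l, y - ybar⟫ : ℝ) : EReal) := by
    refine le_antisymm ((hg.le_segment hr.le hs.le ht.1.le ht.2).trans ?_) ?_
    · refine EReal.coe_le_coe_iff.2 ?_
      have := mul_le_mul_of_nonneg_left (show s - r ≤ ⟪l, y - ybar⟫ by linarith) ht.1.le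
      linarith
    · have := hbar.2 (ybar + t • (y - ybar))
      rw [add_sub_cancel_left, inner_smul_right, hr] at this
      exact_mod_cast this
  rw [hval, hr, ← EReal.coe_sub, ← EReal.coe_div, add_sub_cancel_left,
    mul_div_cancel_left₀ _ ht.1.ne']

/-- The affine minorant of slope `u` at `ybar` bounds `g (y k)` from below, which does the work of
lower semicontinuity. -/
lemma isClosed_graph_subdifferential {g : E m → EReal} (hbot : ∀ y, g y ≠ ⊥) {y l : ℕ → E m}
    {ybar lstar u : E m} (hu : u ∈ subdifferential g ybar)
    (h : ∀ᶠ k in atTop, l k ∈ subdifferential g (y k) ∧ u ∈ subdifferential g (y k))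
    (hy : Tendsto y atTop (𝓝 ybar)) (hl : Tendsto l atTop (𝓝 lstar)) :
    lstar ∈ subdifferential g ybar := by
  obtain ⟨r, hr⟩ := exists_real_of_mem_subdifferential hbot hu
  rw [mem_subdifferential_iff hr]
  intro z t hz
  have hL : Tendsto (fun k => r + ⟪u, y k - ybar⟫ + ⟪l k, z - y k⟫) atTop
      (𝓝 (r + ⟪u, ybar - ybar⟫ + ⟪lstar, z - ybar⟫)) :=
    (tendsto_const_nhds.add (tendsto_const_nhds.inner (hy.sub_const _))).add
      (hl.inner (hy.const_sub _))
  rw [sub_self, inner_zero_right, add_zero] at hL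
  refine le_of_tendsto hL (h.mono fun k hk => ?_)
  obtain ⟨s, hs⟩ := exists_real_of_mem_subdifferential hbot hk.1
  have h1 := (mem_subdifferential_iff hs).1 hk.1 z t hz
  have h2 := (mem_subdifferential_iff hr).1 hu (y k) s hs.le
  linarith

/-- Optimality condition of the proximal step. -/
lemma IsPolyhedralConvex.mem_subdifferential_of_isMinOn {g : E m → EReal}
    (hg : IsPolyhedralConvex g) (hdom : ∃ z, g z ≠ ⊤) {β : ℝ} {p l y : E m}
    (h : IsMinOn (fun z => g z + ((⟪l, -z⟫ + β / 2 * ‖p - z‖ ^ 2 : ℝ) : EReal)) Set.univ y) :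
    l + β • (p - y) ∈ subdifferential g y := by
  have hmin : ∀ z, g y + ((⟪l, -y⟫ + β / 2 * ‖p - y‖ ^ 2 : ℝ) : EReal) ≤
      g z + ((⟪l, -z⟫ + β / 2 * ‖p - z‖ ^ 2 : ℝ) : EReal) := fun z => h (Set.mem_univ z)
  have hfin : g y ≠ ⊤ := by
    obtain ⟨z, hz⟩ := hdom
    intro hy
    have := hmin z
    rw [hy, EReal.top_add_coe, top_le_iff] at this
    obtain ⟨s, hs⟩ : ∃ s : ℝ, g z = s := ⟨_, (EReal.coe_toReal hz (hg.1 z)).symm⟩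
    rw [hs, ← EReal.coe_add] at this
    exact EReal.coe_ne_top _ this
  obtain ⟨r, hr⟩ : ∃ r : ℝ, g y = r := ⟨_, (EReal.coe_toReal hfin (hg.1 y)).symm⟩
  rw [mem_subdifferential_iff hr]
  intro z s hz
  -- Minimality is tested at `y + t(z - y)` and divided by `t`; the quadratic remainder vanishes as
  -- `t ↓ 0`.
  have key : ∀ᶠ t : ℝ in 𝓝[>] 0,
      0 ≤ s - r - ⟪l + β • (p - y), z - y⟫ + t * (β / 2 * ‖z - y‖ ^ 2) := by
    filter_upwards [Ioc_mem_nhdsGT (zero_lt_one' ℝ)] with t ht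
    have h1 := (hmin (y + t • (z - y))).trans
      (add_le_add_left (hg.le_segment hr.le hz ht.1.le ht.2) _)
    rw [hr, ← EReal.coe_add, ← EReal.coe_add, EReal.coe_le_coe_iff] at h1
    have e1 : p - (y + t • (z - y)) = (p - y) - t • (z - y) := by abel
    rw [e1, norm_sub_sq_real (p - y), norm_smul, mul_pow, Real.norm_eq_abs, sq_abs, inner_neg_right,
      inner_neg_right, inner_add_right, inner_smul_right, inner_smul_right] at h1
    rw [inner_add_left, real_inner_smul_left]
    refine le_of_mul_le_mul_left ?_ ht.1
    linarith
  have hL : Tendsto (fun t : ℝ => s - r - ⟪l + β • (p - y), z - y⟫ + t * (β / 2 * ‖z - y‖ ^ 2))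
      (𝓝[>] 0) (𝓝 (s - r - ⟪l + β • (p - y), z - y⟫ + 0 * (β / 2 * ‖z - y‖ ^ 2))) :=
    Tendsto.mono_left (Continuous.tendsto (by fun_prop) _) nhdsWithin_le_nhds
  have := ge_of_tendsto hL key
  linarith

/-! ### First-order conditions -/

lemma firstOrderOptimal_iff {f : E n → ℝ} {g : E m → EReal} {A : E n →L[ℝ] E m}
    {C : Set (E n)} {x : E n} {l : E m} :
    FirstOrderOptimal f g A C x l ↔
      (x ∈ C ∧ ∀ z ∈ C, 0 ≤ fderiv ℝ f x (z - x) + ⟪l, A (z - x)⟫) ∧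
        l ∈ subdifferential g (A x) := by
  have hin : ∀ w, ⟪-(gradient f x + ContinuousLinearMap.adjoint A l), w⟫
      = -(fderiv ℝ f x w + ⟪l, A w⟫) := fun w => by
    rw [inner_neg_left, inner_add_left, ContinuousLinearMap.adjoint_inner_left, gradient,
      InnerProductSpace.toDual_symm_apply]
  refine and_congr_left fun _ => ⟨fun ⟨h1, h2⟩ => ?_, fun ⟨h1, h2⟩ => ⟨by simp [indicatorFn, h1], ?_⟩⟩
  · have hx : x ∈ C := by
      by_contra hx
      exact h1 (by simp [indicatorFn, hx])
    refine ⟨hx, fun z hz => ?_⟩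
    have := h2 z
    rw [hin] at this
    simp only [indicatorFn, hx, hz, if_true, zero_add] at this
    have : -(fderiv ℝ f x (z - x) + ⟪l, A (z - x)⟫) ≤ 0 := by exact_mod_cast this
    linarith
  · intro z
    rw [hin]
    by_cases hz : z ∈ C
    · simp only [indicatorFn, h1, hz, if_true, zero_add]
      have := h2 z hz
      exact_mod_cast (by linarith : -(fderiv ℝ f x (z - x) + ⟪l, A (z - x)⟫) ≤ 0)
    · simp [indicatorFn, hz]

/-- Optimality condition of the step in the primal variable. -/
lemma nonneg_of_isMinOn {f : E n → ℝ} {A : E n →L[ℝ] E m} {C : Set (E n)} (hC : Convex ℝ C)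
    {β : ℝ} {x : E n} {y l : E m} (hx : x ∈ C) (hf : DifferentiableAt ℝ f x)
    (h : IsMinOn (fun z => f z + ⟪l, A z⟫ + β / 2 * ‖A z - y‖ ^ 2) C x) {z : E n} (hz : z ∈ C) :
    0 ≤ fderiv ℝ f x (z - x) + ⟪l + β • (A x - y), A (z - x)⟫ := by
  have hA : HasFDerivAt (fun z => A z - y) A x := A.hasFDerivAt.sub_const y
  have hd := (hf.hasFDerivAt.add ((hasFDerivAt_const l x).inner ℝ A.hasFDerivAt)).add
    (hA.norm_sq.const_mul (β / 2))
  have := h.localize.hasFDerivWithinAt_nonneg hd.hasFDerivWithinAt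
    (sub_mem_posTangentConeAt_of_segment_subset (hC.segment_subset hx hz))
  convert this using 1
  simp [inner_add_left, inner_sub_left, real_inner_smul_left]
  ring

/-- The reduced Lagrangian need not be computed. Dropping the quadratic term and using `l ∈ ∂g(A
x̄)` bounds it below on `C`; choosing `y = A x̄` bounds it above at `x̄` by a value independent of
the multiplier. The bounds meet at `(x̄, l)`. -/
lemma mem_multiplierSet {f : E n → ℝ} {g : E m → EReal} (hbot : ∀ y, g y ≠ ⊥)
    {A : E n →L[ℝ] E m} {C : Set (E n)} {β : ℝ} (hβ : 0 ≤ β) {xbar : E n} {Λ : Set (E m)}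
    {l : E m} (hf : DifferentiableAt ℝ f xbar) (hl : l ∈ Λ)
    (h : FirstOrderOptimal f g A C xbar l) : l ∈ multiplierSet f g A C β xbar Λ := by
  obtain ⟨⟨hx, hN⟩, hg⟩ := firstOrderOptimal_iff.1 h
  obtain ⟨r, hr⟩ := exists_real_of_mem_subdifferential hbot hg
  have hlow : ∀ x ∈ C, ((f x + r + ⟪l, A (x - xbar)⟫ : ℝ) : EReal) ≤
      reducedLagrangian f g A C β x l := by
    intro x hxC
    refine le_iInf fun y => ?_
    simp only [augLagrangian, indicatorFn, hxC, if_true, add_zero]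
    by_cases hy : g y = ⊤
    · rw [hy, EReal.coe_add_top, EReal.top_add_coe]
      exact le_top
    obtain ⟨s, hs⟩ : ∃ s : ℝ, g y = s := ⟨_, (EReal.coe_toReal hy (hbot y)).symm⟩
    have h1 := (mem_subdifferential_iff hr).1 hg y s hs.le
    rw [hs, ← EReal.coe_add, ← EReal.coe_add, EReal.coe_le_coe_iff]
    have h2 : 0 ≤ β / 2 * ‖A x - y‖ ^ 2 := by positivity
    have e : ⟪l, A (x - xbar)⟫ = ⟪l, A x - y⟫ + ⟪l, y - A xbar⟫ := by
      rw [← inner_add_right, map_sub]; simp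
    linarith
  have hup : ∀ l', reducedLagrangian f g A C β xbar l' ≤ ((f xbar + r : ℝ) : EReal) := by
    intro l'
    refine (iInf_le _ (A xbar)).trans ?_
    simp [augLagrangian, indicatorFn, hx, hr]
  have hval : reducedLagrangian f g A C β xbar l = ((f xbar + r : ℝ) : EReal) :=
    le_antisymm (hup l) (by simpa using hlow xbar hx)
  refine ⟨hl, ⟨?_, ?_, fun ε hε => ?_⟩, ⟨?_, ?_, fun ε hε => Eventually.of_forall fun l' => ?_⟩⟩
  · simp only [hval]; exact EReal.coe_ne_top _
  · simp only [hval]; exact EReal.coe_ne_bot _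
  · have ho := (hasFDerivAt_iff_isLittleO.1 hf.hasFDerivAt).def hε
    filter_upwards [ho] with x hxε
    by_cases hxC : x ∈ C
    · refine le_trans ?_ (hlow x hxC)
      simp only [hval]
      rw [← EReal.coe_add, EReal.coe_le_coe_iff, inner_zero_left]
      rw [Real.norm_eq_abs] at hxε
      have := (abs_le.1 hxε).1
      have := hN x hxC
      linarith
    · have : reducedLagrangian f g A C β x l = ⊤ := by
        refine iInf_eq_top.2 fun y => ?_
        simp only [augLagrangian, indicatorFn, hxC, if_false]
        rw [EReal.coe_add_top, EReal.top_add_of_ne_bot (hbot y), EReal.top_add_coe]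
      simp only [this]
      exact le_top
  · simp only [hval, ← EReal.coe_neg]; exact EReal.coe_ne_top _
  · simp only [hval, ← EReal.coe_neg]; exact EReal.coe_ne_bot _
  · simp only [hval]
    refine le_trans ?_ (EReal.neg_le_neg_iff.2 (hup l'))
    rw [← EReal.coe_neg, ← EReal.coe_add, EReal.coe_le_coe_iff, inner_zero_left]
    have : 0 ≤ ε * ‖l' - l‖ := by positivity
    linarith

/-! ### Second-order conditions -/

/-- Finsler's lemma. -/
lemma exists_pos_penalty {V F : Type*} [NormedAddCommGroup V] [InnerProductSpace ℝ V]
    [FiniteDimensional ℝ V] [NormedAddCommGroup F] [InnerProductSpace ℝ F]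
    (H : V →L[ℝ] V →L[ℝ] ℝ) (B : V →L[ℝ] F) (W : Submodule ℝ V)
    (h : ∀ v ∈ W, B v = 0 → v ≠ 0 → 0 < H v v) :
    ∃ b c : ℝ, 0 < b ∧ 0 < c ∧ ∀ v ∈ W, c * ‖v‖ ^ 2 ≤ H v v + b * ‖B v‖ ^ 2 := by
  have hHc : Continuous fun v => H v v := by fun_prop
  have hBc : Continuous fun v => ‖B v‖ ^ 2 := by fun_prop
  have hK : IsCompact ((W : Set V) ∩ Metric.sphere 0 1) :=
    (isCompact_sphere 0 1).inter_left W.closed_of_finiteDimensional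
  -- These open sets increase with `k` and cover the unit sphere of `W`, so by compactness one `k`
  -- supplies both constants; homogeneity then extends the bound.
  obtain ⟨k, hk⟩ := hK.elim_directed_cover
    (fun k : ℕ => {v : V | 1 / ((k : ℝ) + 1) < H v v + ((k : ℝ) + 1) * ‖B v‖ ^ 2})
    (fun k => isOpen_lt continuous_const (hHc.add (continuous_const.mul hBc)))
    (fun v hv => by
      have hv0 : v ≠ 0 := by
        rintro rfl
        simpa using hv.2
      rw [Set.mem_iUnion]
      by_cases hB : B v = 0
      · obtain ⟨k, hk⟩ := exists_nat_one_div_lt (h v hv.1 hB hv0)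
        exact ⟨k, by simpa [hB] using hk⟩
      · have hq : 0 < ‖B v‖ ^ 2 := by positivity
        obtain ⟨k, hk⟩ := exists_nat_gt ((1 - H v v) / ‖B v‖ ^ 2)
        rw [div_lt_iff₀ hq] at hk
        refine ⟨k, ?_⟩
        have : 1 / ((k : ℝ) + 1) ≤ 1 := by
          rw [div_le_one (by positivity)]; linarith [k.cast_nonneg (α := ℝ)]
        simp only [Set.mem_ofPred_eq]
        linarith)
    (Monotone.directed_le fun i j hij v hv => by
      have hij' : (i : ℝ) + 1 ≤ j + 1 := by exact_mod_cast Nat.succ_le_succ hij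
      have h1 : 1 / ((j : ℝ) + 1) ≤ 1 / ((i : ℝ) + 1) :=
        one_div_le_one_div_of_le (by positivity) hij'
      have h2 := mul_le_mul_of_nonneg_right hij' (sq_nonneg ‖B v‖)
      simp only [Set.mem_ofPred_eq] at hv ⊢
      linarith)
  refine ⟨k + 1, 1 / (k + 1), by positivity, by positivity, fun v hv => ?_⟩
  by_cases hv0 : v = 0
  · simp [hv0]
  have hpos : 0 < ‖v‖ := norm_pos_iff.2 hv0
  have := hk ⟨W.smul_mem ‖v‖⁻¹ hv, by simp [norm_smul, hpos.ne']⟩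
  simp only [Set.mem_ofPred_eq, map_smul, smul_apply, smul_eq_mul, norm_smul,
    norm_inv, norm_norm] at this
  have := mul_le_mul_of_nonneg_right this.le (sq_nonneg ‖v‖)
  have e : (‖v‖⁻¹ * (‖v‖⁻¹ * H v v) + (k + 1) * (‖v‖⁻¹ * ‖B v‖) ^ 2) * ‖v‖ ^ 2
      = H v v + (k + 1) * ‖B v‖ ^ 2 := by
    field_simp
  rwa [e] at this

lemma SecondOrderAssumption.exists_monotone {f : E n → ℝ} {g : E m → EReal}
    {A : E n →L[ℝ] E m} {C : Set (E n)} {xbar : E n} {lbar : E m}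
    (h : SecondOrderAssumption f g A C xbar lbar) :
    ∃ b c : ℝ, 0 < b ∧ 0 < c ∧ ∀ᶠ x in 𝓝 xbar, DifferentiableAt ℝ f x ∧
      (x ∈ C → ∀ s ∈ tangentSpan g (A xbar) lbar, c * ‖x - xbar‖ ^ 2 ≤
        fderiv ℝ f x (x - xbar) - fderiv ℝ f xbar (x - xbar)
          + b * ‖A (x - xbar) - s‖ ^ 2) := by
  set S := tangentSpan g (A xbar) lbar
  obtain ⟨b, c, hb, hc, hbc⟩ := exists_pos_penalty (fderiv ℝ (fderiv ℝ f) xbar)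
    (Sᗮ.starProjection ∘L A) (affineSpan ℝ C).direction fun v hv hB hv0 => by
      refine h.hessian_pos v hv ?_ hv0
      have : A v ∈ Sᗮᗮ := by
        rw [← Submodule.starProjection_apply_eq_zero_iff]
        exact hB
      rwa [Submodule.orthogonal_orthogonal] at this
  obtain ⟨U, hU, hxU, hfU⟩ := h.smooth_near
  have hf2 : ContDiffAt ℝ 2 f xbar := hfU.contDiffAt (hU.mem_nhds hxU)
  have hdd : DifferentiableAt ℝ (fderiv ℝ f) xbar :=
    (hf2.fderiv_right (m := 1) (by norm_num)).differentiableAt (by norm_num)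
  have ho := (hasFDerivAt_iff_isLittleO.1 hdd.hasFDerivAt).def (half_pos hc)
  -- The other half of `c` pays for the linearization error of `fderiv ℝ f` at `xbar`.
  refine ⟨b, c / 2, hb, half_pos hc, ?_⟩
  filter_upwards [ho, hU.mem_nhds hxU] with x hx hxU'
  refine ⟨(hfU.contDiffAt (hU.mem_nhds hxU')).differentiableAt (by norm_num), fun hxC s hs => ?_⟩
  have hxb : xbar ∈ C := (firstOrderOptimal_iff.1 h.first_order).1.1
  have hv : x - xbar ∈ (affineSpan ℝ C).direction :=
    AffineSubspace.vsub_mem_direction (subset_affineSpan ℝ C hxC) (subset_affineSpan ℝ C hxb)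
  have h1 := hbc _ hv
  -- Projection onto `Sᗮ` kills `s` and does not increase norms.
  have h2 : ‖(Sᗮ.starProjection ∘L A) (x - xbar)‖ ^ 2 ≤ ‖A (x - xbar) - s‖ ^ 2 := by
    have e : (Sᗮ.starProjection ∘L A) (x - xbar) = Sᗮ.starProjection (A (x - xbar) - s) := by
      have : Sᗮ.starProjection s = 0 := by
        rw [Submodule.starProjection_apply_eq_zero_iff, Submodule.orthogonal_orthogonal]
        exact hs
      rw [map_sub _ (A _), this, sub_zero]
      rfl
    rw [e]
    gcongr
    exact Submodule.norm_starProjection_apply_le _ _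
  have h3 := mul_le_mul_of_nonneg_left h2 hb.le
  have h4 := ContinuousLinearMap.le_opNorm
    (fderiv ℝ f x - fderiv ℝ f xbar - fderiv ℝ (fderiv ℝ f) xbar (x - xbar)) (x - xbar)
  have h5 := h4.trans (mul_le_mul_of_nonneg_right hx (norm_nonneg (x - xbar)))
  rw [Real.norm_eq_abs] at h5
  have h6 := (abs_le.1 h5).1
  simp only [sub_apply] at h6
  nlinarith

/-! ### Convergence of the method -/

/-- In the variables `r = p - y'`, `d = y' - y`, `e = y' - ybar`, `a = l' - lstar`, expanding the
squares leaves `⟪a, r⟫ + β⟪d, e⟫ + c ≤ b‖r‖²` to prove, up to the factor `2β`. This follows from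
`hx` and `hD` after discarding `⟪a, e⟫` and `β⟪d, r⟫`, nonnegative by `hy` and `hm`. -/
lemma lyapunov_descent {F : Type*} [NormedAddCommGroup F] [InnerProductSpace ℝ F]
    {y y' ybar l l' lstar p : F} {β b c D : ℝ} (hβ : 0 ≤ β) (hl : l' = l + β • (p - y'))
    (hx : D + ⟪l + β • (p - y) - lstar, p - ybar⟫ ≤ 0)
    (hD : c ≤ D + b * ‖p - y'‖ ^ 2) (hy : 0 ≤ ⟪l' - lstar, y' - ybar⟫)
    (hm : 0 ≤ ⟪l' - l, y' - y⟫) :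
    (β ^ 2 * ‖y' - ybar‖ ^ 2 + ‖l' - lstar‖ ^ 2) + β * (β - 2 * b) * ‖p - y'‖ ^ 2
      + β ^ 2 * ‖y' - y‖ ^ 2 + 2 * β * c ≤ β ^ 2 * ‖y - ybar‖ ^ 2 + ‖l - lstar‖ ^ 2 := by
  obtain ⟨r, rfl⟩ : ∃ r, p = y' + r := ⟨p - y', by abel⟩
  obtain ⟨d, rfl⟩ : ∃ d, y = y' - d := ⟨y' - y, by abel⟩
  obtain ⟨e, rfl⟩ : ∃ e, ybar = y' - e := ⟨y' - ybar, by abel⟩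
  obtain ⟨a, rfl⟩ : ∃ a, lstar = l' - a := ⟨l' - lstar, by abel⟩
  obtain rfl : l = l' - β • r := by rw [hl]; simp
  have e1 : l' - β • r + β • (y' + r - (y' - d)) - (l' - a) = a + β • d := by
    rw [show y' + r - (y' - d) = r + d by abel, smul_add]; abel
  have e2 : y' + r - (y' - e) = r + e := by abel
  have e3 : y' - d - (y' - e) = e - d := by abel
  have e4 : l' - β • r - (l' - a) = a - β • r := by abel
  rw [e1, e2] at hx
  rw [e3, e4]
  simp only [sub_sub_cancel, add_sub_cancel_left] at *
  rw [norm_sub_sq_real, norm_sub_sq_real, norm_smul, mul_pow, Real.norm_eq_abs, sq_abs,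
    inner_smul_right]
  simp only [inner_add_left, inner_add_right, real_inner_smul_left] at hx hm
  rw [real_inner_comm d e, real_inner_comm d r] at *
  have := mul_le_mul_of_nonneg_left hx hβ
  have := mul_le_mul_of_nonneg_left hD hβ
  have := mul_nonneg hβ hy
  have := mul_nonneg hβ hm
  linarith

lemma tendsto_zero_of_descent {F : Type*} [NormedAddCommGroup F] {a : ℕ → ℝ} {u : ℕ → F}
    {c : ℝ} (hc : 0 < c) (ha : ∀ k, 0 ≤ a k) (h : ∀ k, a (k + 1) + c * ‖u k‖ ^ 2 ≤ a k) :
    Tendsto u atTop (𝓝 0) := by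
  have hanti : Antitone a := antitone_nat_of_succ_le fun k => by
    have : 0 ≤ c * ‖u k‖ ^ 2 := by positivity
    linarith [h k]
  have hlim := tendsto_atTop_ciInf hanti ⟨0, by rintro _ ⟨k, rfl⟩; exact ha k⟩
  have hdiff := (hlim.sub (hlim.comp (tendsto_add_atTop_nat 1))).div_const c
  rw [sub_self, zero_div] at hdiff
  have hsq : Tendsto (fun k => ‖u k‖ ^ 2) atTop (𝓝 0) := by
    refine squeeze_zero (fun k => by positivity) (fun k => ?_) hdiff
    rw [le_div_iff₀ hc]
    have := h k
    simp only [Function.comp_apply]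
    linarith
  rw [tendsto_zero_iff_norm_tendsto_zero]
  simpa using hsq.sqrt

section Iterates

variable {f : E n → ℝ} {g : E m → EReal} {A : E n →L[ℝ] E m} {C : Set (E n)} {β : ℝ}
  {x : ℕ → E n} {y l : ℕ → E m} {xbar : E n} {lbar lstar : E m}

lemma IsADMMSequence.mem_subdifferential (h : IsADMMSequence f g A C β x y l)
    (hg : IsPolyhedralConvex g) (hdom : ∃ z, g z ≠ ⊤) (h0 : l 0 ∈ subdifferential g (y 0))
    (k : ℕ) : l k ∈ subdifferential g (y k) := by
  cases k with
  | zero => exact h0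
  | succ k =>
    rw [h.l_step]
    exact hg.mem_subdifferential_of_isMinOn hdom (h.y_min k)

/-- An a priori bound, needed before descent is available: it keeps the next multiplier where
polyhedrality applies. Monotonicity of `∂g` allows the `y` term to be dropped. -/
lemma IsADMMSequence.norm_sub_le (h : IsADMMSequence f g A C β x y l) (hbot : ∀ y, g y ≠ ⊥)
    (hβ : 0 ≤ β) (hbar : lbar ∈ subdifferential g (A xbar)) {k : ℕ}
    (hk : l (k + 1) ∈ subdifferential g (y (k + 1))) :
    ‖l (k + 1) - lbar‖ ≤ ‖l k - lbar‖ + β * ‖A (x (k + 1) - xbar)‖ := by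
  have hmono := mul_nonneg hβ (subdifferential_monotone hbot hk hbar)
  have e : l (k + 1) - lbar = (l k - lbar + β • A (x (k + 1) - xbar))
      - β • (y (k + 1) - A xbar) := by
    rw [h.l_step, map_sub]
    module
  have h1 : ‖l (k + 1) - lbar‖ ^ 2 ≤
      ‖l (k + 1) - lbar‖ * ‖l k - lbar + β • A (x (k + 1) - xbar)‖ := by
    refine le_trans ?_ (real_inner_le_norm _ _)
    rw [← real_inner_self_eq_norm_sq]
    nth_rewrite 2 [e]
    rw [inner_sub_right, inner_smul_right]
    linarith
  have h2 : ‖l (k + 1) - lbar‖ ≤ ‖l k - lbar + β • A (x (k + 1) - xbar)‖ := by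
    rcases (norm_nonneg (l (k + 1) - lbar)).eq_or_lt with h0 | h0
    · rw [← h0]; positivity
    · exact le_of_mul_le_mul_left (by rwa [← sq]) h0
  refine h2.trans ((norm_add_le _ _).trans_eq ?_)
  rw [norm_smul, Real.norm_of_nonneg hβ]

lemma IsADMMSequence.descent (h : IsADMMSequence f g A C β x y l) (hC : Convex ℝ C)
    (hbot : ∀ y, g y ≠ ⊥) (hβ : 0 ≤ β) {b c : ℝ} {S : Submodule ℝ (E m)} {k : ℕ}
    (hstar : FirstOrderOptimal f g A C xbar lstar)
    (hsub : ∀ k, l k ∈ subdifferential g (y k)) (hS : y (k + 1) - A xbar ∈ S)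
    (hf : DifferentiableAt ℝ f (x (k + 1)))
    (hmono : ∀ s ∈ S, c * ‖x (k + 1) - xbar‖ ^ 2 ≤
      fderiv ℝ f (x (k + 1)) (x (k + 1) - xbar) - fderiv ℝ f xbar (x (k + 1) - xbar)
        + b * ‖A (x (k + 1) - xbar) - s‖ ^ 2) :
    (β ^ 2 * ‖y (k + 1) - A xbar‖ ^ 2 + ‖l (k + 1) - lstar‖ ^ 2)
      + β * (β - 2 * b) * ‖A (x (k + 1)) - y (k + 1)‖ ^ 2
      + β ^ 2 * ‖y (k + 1) - y k‖ ^ 2 + 2 * β * (c * ‖x (k + 1) - xbar‖ ^ 2) ≤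
      β ^ 2 * ‖y k - A xbar‖ ^ 2 + ‖l k - lstar‖ ^ 2 := by
  obtain ⟨⟨hxb, hN⟩, hg⟩ := firstOrderOptimal_iff.1 hstar
  have h1 := nonneg_of_isMinOn hC (h.x_mem k) hf (h.x_min k) hxb
  have h2 := hN _ (h.x_mem k)
  have h3 := hmono _ hS
  rw [map_sub A, sub_sub_sub_cancel_right] at h3
  refine lyapunov_descent hβ (h.l_step k) ?_ h3
    (subdifferential_monotone hbot (hsub _) hg)
    (subdifferential_monotone hbot (hsub _) (hsub _))
  rw [← neg_sub, map_neg, map_neg, inner_neg_right] at h1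
  rw [inner_sub_left, ← map_sub]
  linarith

lemma IsADMMSequence.converges (h : IsADMMSequence f g A C β x y l) (hC : Convex ℝ C)
    (hbot : ∀ y, g y ≠ ⊥) {b c : ℝ} (hβ : 0 < β) (hb : 2 * b < β) (hc : 0 < c)
    (hfc : ContinuousAt (fderiv ℝ f) xbar) (hbar : FirstOrderOptimal f g A C xbar lbar)
    (hsub : ∀ k, l k ∈ subdifferential g (y k))
    (hsubbar : ∀ k, lbar ∈ subdifferential g (y (k + 1)))
    (hf : ∀ k, DifferentiableAt ℝ f (x (k + 1)))
    (hdesc : ∀ lstar, FirstOrderOptimal f g A C xbar lstar → ∀ k,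
      (β ^ 2 * ‖y (k + 1) - A xbar‖ ^ 2 + ‖l (k + 1) - lstar‖ ^ 2)
        + β * (β - 2 * b) * ‖A (x (k + 1)) - y (k + 1)‖ ^ 2
        + β ^ 2 * ‖y (k + 1) - y k‖ ^ 2 + 2 * β * (c * ‖x (k + 1) - xbar‖ ^ 2) ≤
        β ^ 2 * ‖y k - A xbar‖ ^ 2 + ‖l k - lstar‖ ^ 2) {Λ : Set (E m)} (hΛ : IsCompact Λ)
    (hl : ∀ k, l k ∈ Λ) :
    ∃ lstar ∈ Λ, FirstOrderOptimal f g A C xbar lstar ∧ Tendsto x atTop (𝓝 xbar) ∧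
      Tendsto y atTop (𝓝 (A xbar)) ∧ Tendsto l atTop (𝓝 lstar) := by
  obtain ⟨⟨hxb, -⟩, hg⟩ := firstOrderOptimal_iff.1 hbar
  have hb' : 0 < β * (β - 2 * b) := mul_pos hβ (by linarith)
  have hpos : ∀ ls k, 0 ≤ β ^ 2 * ‖y k - A xbar‖ ^ 2 + ‖l k - ls‖ ^ 2 := fun _ _ => by positivity
  have hx0 : Tendsto (fun k => x (k + 1) - xbar) atTop (𝓝 0) := by
    refine tendsto_zero_of_descent (c := 2 * β * c) (by positivity) (hpos lbar) fun k => ?_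
    have := hdesc lbar hbar k
    have : 0 ≤ β * (β - 2 * b) * ‖A (x (k + 1)) - y (k + 1)‖ ^ 2 := by positivity
    have : 0 ≤ β ^ 2 * ‖y (k + 1) - y k‖ ^ 2 := by positivity
    linarith
  have hr0 : Tendsto (fun k => A (x (k + 1)) - y (k + 1)) atTop (𝓝 0) := by
    refine tendsto_zero_of_descent hb' (hpos lbar) fun k => ?_
    have := hdesc lbar hbar k
    have : 0 ≤ 2 * β * (c * ‖x (k + 1) - xbar‖ ^ 2) := by positivity
    have : 0 ≤ β ^ 2 * ‖y (k + 1) - y k‖ ^ 2 := by positivity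
    linarith
  have hx1 : Tendsto (fun k => x (k + 1)) atTop (𝓝 xbar) := tendsto_sub_nhds_zero_iff.1 hx0
  have hAx : Tendsto (fun k => A (x (k + 1))) atTop (𝓝 (A xbar)) :=
    (A.continuous.tendsto xbar).comp hx1
  have hy1 : Tendsto (fun k => y (k + 1)) atTop (𝓝 (A xbar)) := by
    simpa using hAx.sub hr0
  have hx : Tendsto x atTop (𝓝 xbar) := (tendsto_add_atTop_iff_nat 1).1 hx1
  have hy : Tendsto y atTop (𝓝 (A xbar)) := (tendsto_add_atTop_iff_nat 1).1 hy1
  obtain ⟨lstar, hlΛ, φ, hφ, hlim⟩ := hΛ.tendsto_subseq hl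
  have hφt := hφ.tendsto_atTop
  have hstar : FirstOrderOptimal f g A C xbar lstar := by
    refine firstOrderOptimal_iff.2 ⟨⟨hxb, fun z hz => ?_⟩, ?_⟩
    · have hxφ := hx1.comp hφt
      have hd : Tendsto (fun k => fderiv ℝ f (x (φ k + 1)) (z - x (φ k + 1))) atTop
          (𝓝 (fderiv ℝ f xbar (z - xbar))) :=
        ((isBoundedBilinearMap_apply (𝕜 := ℝ)).continuous.tendsto
          (fderiv ℝ f xbar, z - xbar)).comp
            ((hfc.tendsto.comp hxφ).prodMk_nhds (hxφ.const_sub z))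
      -- The multiplier in the optimality condition of the `x` step uses the old `y`; the correction
      -- vanishes because `A x` and `y` share the limit `A xbar`.
      have hμ : Tendsto (fun k => l (φ k) + β • (A (x (φ k + 1)) - y (φ k))) atTop
          (𝓝 lstar) := by
        simpa using hlim.add (((hAx.comp hφt).sub (hy.comp hφt)).const_smul β)
      have hi : Tendsto (fun k => A (z - x (φ k + 1))) atTop (𝓝 (A (z - xbar))) :=
        (A.continuous.tendsto _).comp (hxφ.const_sub z)
      exact ge_of_tendsto' (hd.add (hμ.inner hi)) fun k =>
        nonneg_of_isMinOn hC (h.x_mem _) (hf _) (h.x_min _) hz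
    · refine isClosed_graph_subdifferential hbot hg ?_ (hy.comp hφt) hlim
      filter_upwards [hφt.eventually_ge_atTop 1] with k hk
      refine ⟨hsub _, ?_⟩
      obtain ⟨j, hj⟩ := Nat.exists_eq_add_of_le' hk
      simp only [Function.comp_apply, hj]
      exact hsubbar j
  refine ⟨lstar, hlΛ, hstar, hx, hy, ?_⟩
  -- With the cluster point as reference multiplier, the Lyapunov values decrease and tend to zero
  -- along `φ`, hence along the full sequence.
  have hanti : Antitone fun k => β ^ 2 * ‖y k - A xbar‖ ^ 2 + ‖l k - lstar‖ ^ 2 :=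
    antitone_nat_of_succ_le fun k => by
      have := hdesc lstar hstar k
      have : 0 ≤ β * (β - 2 * b) * ‖A (x (k + 1)) - y (k + 1)‖ ^ 2 := by positivity
      have : 0 ≤ β ^ 2 * ‖y (k + 1) - y k‖ ^ 2 := by positivity
      have : 0 ≤ 2 * β * (c * ‖x (k + 1) - xbar‖ ^ 2) := by positivity
      linarith
  have hV := tendsto_atTop_ciInf hanti ⟨0, by rintro _ ⟨k, rfl⟩; exact hpos lstar k⟩
  have hV0 : Tendsto (fun k => β ^ 2 * ‖y (φ k) - A xbar‖ ^ 2 + ‖l (φ k) - lstar‖ ^ 2) atTop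
      (𝓝 0) := by
    simpa using ((((hy.comp hφt).sub_const (A xbar)).norm.pow 2).const_mul (β ^ 2)).add
      ((hlim.sub_const lstar).norm.pow 2)
  rw [tendsto_nhds_unique (hV.comp hφt) hV0] at hV
  have hsq : Tendsto (fun k => ‖l k - lstar‖ ^ 2) atTop (𝓝 0) :=
    squeeze_zero (fun k => by positivity) (fun k => le_add_of_nonneg_left (by positivity)) hV
  rw [tendsto_iff_norm_sub_tendsto_zero]
  simpa using hsq.sqrt

end Iterates

lemma mem_of_ball_subset {F : Type*} [NormedAddCommGroup F] [NormedSpace ℝ F] {Λ : Set F}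
    (hΛ : IsClosed Λ) {a u : F} {r : ℝ} (ha : a ∈ Λ) (hball : Metric.ball a r ⊆ Λ)
    (hu : ‖u - a‖ ≤ r) : u ∈ Λ := by
  -- For `r = 0` the open ball is empty and gives nothing, so `ha` is used instead.
  rcases ((norm_nonneg _).trans hu).eq_or_lt with h0 | h0
  · rw [← h0, norm_le_zero_iff, sub_eq_zero] at hu
    rwa [hu]
  · have hcl := hΛ.closure_subset_iff.2 hball
    rw [closure_ball a h0.ne'] at hcl
    exact hcl (mem_closedBall_iff_norm.2 hu)

end ADMM

theorem mainTheorem4 {n m : ℕ} (f : ADMM.E n → ℝ) (g : ADMM.E m → EReal)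
    (A : ADMM.E n →L[ℝ] ADMM.E m) (C : Set (ADMM.E n))
    (hP : ADMM.IsCompositeProblem f g A C)
    (xbar : ADMM.E n) (lbar : ADMM.E m)
    (hA : ADMM.SecondOrderAssumption f g A C xbar lbar) :
    ∃ β₀ : ℝ, 0 < β₀ ∧ ∀ β : ℝ, 2 * β₀ < β →
      ∃ (X : Set (ADMM.E n)) (Λ : Set (ADMM.E m)),
        IsClosed X ∧ X ∈ 𝓝 xbar ∧ IsClosed Λ ∧ Λ ∈ 𝓝 lbar ∧
        ∀ (x : ℕ → ADMM.E n) (y l : ℕ → ADMM.E m),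
          ADMM.IsADMMSequence f g A C β x y l →
          l 0 ∈ Λ → l 0 ∈ ADMM.subdifferential g (y 0) →
          Metric.ball lbar
            (Real.sqrt (β ^ 2 * ‖y 0 - A xbar‖ ^ 2 + ‖l 0 - lbar‖ ^ 2)) ⊆ Λ →
          (∀ k : ℕ, 1 ≤ k → x k ∈ X) →
          ∃ lstar ∈ ADMM.multiplierSet f g A C β xbar Λ,
            Tendsto x atTop (𝓝 xbar) ∧ Tendsto y atTop (𝓝 (A xbar)) ∧
              Tendsto l atTop (𝓝 lstar) := by 
  obtain ⟨b, c, hb, hc, hmono⟩ := hA.exists_monotone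
  have hg := hP.polyhedral_g
  have hbot := hg.1
  have hbar := hA.first_order
  obtain ⟨⟨hxb, -⟩, hlbar⟩ := ADMM.firstOrderOptimal_iff.1 hbar
  have hfc : ContinuousAt (fderiv ℝ f) xbar := by
    obtain ⟨U, hU, hxU, hfU⟩ := hA.smooth_near
    exact ((hfU.contDiffAt (hU.mem_nhds hxU)).fderiv_right (m := 1)
      (by norm_num)).continuousAt
  refine ⟨b, hb, fun β hβb => ?_⟩
  have hβ : 0 < β := by linarith
  obtain ⟨ρ, hρ, hG⟩ := Metric.eventually_nhds_iff_ball.1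
    (hg.eventually_mem_subdifferential lbar)
  have hAsmall : ∀ᶠ z in 𝓝 xbar, β * ‖A (z - xbar)‖ < ρ / 2 := by
    have hcont : Continuous fun z => β * ‖A (z - xbar)‖ := by fun_prop
    exact hcont.continuousAt.eventually_lt continuousAt_const (by simpa using half_pos hρ)
  obtain ⟨δ, hδ, hX⟩ := Metric.nhds_basis_closedBall.eventually_iff.1 (hmono.and hAsmall)
  -- One step from `Λ` increases the distance to `lbar` by less than `ρ / 2`, so the new multiplier
  -- stays in the ball of radius `ρ` given by polyhedrality.
  refine ⟨Metric.closedBall xbar δ, Metric.closedBall lbar (ρ / 2), Metric.isClosed_closedBall,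
    Metric.closedBall_mem_nhds _ hδ, Metric.isClosed_closedBall,
    Metric.closedBall_mem_nhds _ (half_pos hρ), fun x y l h hl0 hs0 hball hxX => ?_⟩
  have hsub := h.mem_subdifferential hg ⟨_, hlbar.1⟩ hs0
  have hXk : ∀ k, _ := fun k => hX (hxX (k + 1) (Nat.le_add_left 1 k))
  have hsubbar : ∀ k, l k ∈ Metric.closedBall lbar (ρ / 2) →
      lbar ∈ ADMM.subdifferential g (y (k + 1)) := by
    intro k hk
    rw [mem_closedBall_iff_norm] at hk
    have h1 := h.norm_sub_le hbot hβ.le hlbar (hsub (k + 1))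
    exact hG _ (mem_ball_iff_norm.2 (by linarith [(hXk k).2])) _ (hsub (k + 1))
  have hdesc : ∀ lstar, ADMM.FirstOrderOptimal f g A C xbar lstar → ∀ k,
      l k ∈ Metric.closedBall lbar (ρ / 2) → _ := fun lstar hstar k hk =>
    h.descent hP.convex_C hbot hβ.le hstar hsub
      (Submodule.subset_span (hg.sub_mem_dirTangent hlbar (hsubbar k hk)))
      (hXk k).1.1 ((hXk k).1.2 (h.x_mem k))
  -- Descent needs only the old multiplier in `Λ`; it bounds the new one's distance to `lbar` by the
  -- initial radius, and `hball` returns it to `Λ`.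
  have hmem : ∀ k, l k ∈ Metric.closedBall lbar (ρ / 2) ∧
      β ^ 2 * ‖y k - A xbar‖ ^ 2 + ‖l k - lbar‖ ^ 2 ≤
        β ^ 2 * ‖y 0 - A xbar‖ ^ 2 + ‖l 0 - lbar‖ ^ 2 := by
    intro k
    induction k with
    | zero => exact ⟨hl0, le_rfl⟩
    | succ k ih =>
      have hd := hdesc lbar hbar k ih.1
      have : 0 ≤ β * (β - 2 * b) * ‖A (x (k + 1)) - y (k + 1)‖ ^ 2 :=
        mul_nonneg (mul_nonneg hβ.le (by linarith)) (sq_nonneg _)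
      have : 0 ≤ β ^ 2 * ‖y (k + 1) - y k‖ ^ 2 := by positivity
      have : 0 ≤ 2 * β * (c * ‖x (k + 1) - xbar‖ ^ 2) := by positivity
      have hV : β ^ 2 * ‖y (k + 1) - A xbar‖ ^ 2 + ‖l (k + 1) - lbar‖ ^ 2 ≤
          β ^ 2 * ‖y 0 - A xbar‖ ^ 2 + ‖l 0 - lbar‖ ^ 2 := by linarith [ih.2]
      refine ⟨ADMM.mem_of_ball_subset Metric.isClosed_closedBall
        (Metric.mem_closedBall_self (half_pos hρ).le) hball (Real.le_sqrt_of_sq_le ?_), hV⟩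
      have : 0 ≤ β ^ 2 * ‖y (k + 1) - A xbar‖ ^ 2 := by positivity
      linarith
  obtain ⟨lstar, hlΛ, hstar, hlim⟩ := h.converges hP.convex_C hbot hβ hβb hc hfc hbar hsub
    (fun k => hsubbar k (hmem k).1) (fun k => (hXk k).1.1)
    (fun lstar hstar k => hdesc lstar hstar k (hmem k).1) (isCompact_closedBall lbar (ρ / 2))
    (fun k => (hmem k).1)
  exact ⟨lstar, ADMM.mem_multiplierSet hbot hβ.le
    (hX (Metric.mem_closedBall_self hδ.le)).1.1 hlΛ hstar, hlim⟩
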